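/- **Setting.** A deep belief network (DBN) with $L\ge 2$ layers, each consisting of $n$ units with finite state spaces of cardinalities $q_1,\dots,q_n\ge 1$, is the following family of probability distributions on $\mathcal X=\prod_{i=1}^n\{1,\dots,q_i\}$. Write $h^1,\dots,h^L\in\mathcal X$ for the states of the layers, with $h^1$ visible and the others hidden. The deepest two layers form a restricted Boltzmann machine, $$p(h^{L-1},h^L)\propto\exp\Big(\sum_i b_i(h^{L-1}_i)+\sum_j c_j(h^L_j)+\sum_{i,j}W_{ij}(h^{L-1}_i,h^L_j)\Big),$$ and for $1\le l\le L-2$ the units of layer $l$ are conditionally independent given layer $l+1$, with $$p(h^l_i=a\mid h^{l+1})\propto\exp\Big(b^l_i(a)+\sum_jW^l_{ij}(a,h^{l+1}_j)\Big).$$ The model $\mathrm{DBN}$ is the set of all marginal distributions on $h^1$ of $p(h^{L-1},h^L)\prod_{l=1}^{L-2}p(h^l\mid h^{l+1})$, where all biases $b_i,c_j,b^l_i$ and interaction tables $W_{ij},W^l_{ij}$ range over arbitrary real-valued functions. Let $$D_{\mathrm{DBN}}=\sup_{p}\ \inf_{r\in\mathrm{DBN}}\ \sum_{x\in\mathcal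 X}p(x)\log\frac{p(x)}{r(x)},$$ where $p$ ranges over all probability distributions on $\mathcal X$. **Theorem.** Let $m$ be an integer with $\prod_{j=m+2}^{n}q_j\le m\le n$ (an empty product is $1$), and suppose that $q_1\ge\cdots\ge q_m\ge 2$. If $$L\ \ge\ 2+\frac{q_1^S-1}{q_1-1}\qquad\text{for some }S\in\{0,1,\dots,m\},$$ then $$D_{\mathrm{DBN}}\ \le\ \log\prod_{j=1}^{m-S}q_j .$$ In particular, let $k\ge 1$ be an integer. If all units are binary and the network has $L\ge 1+2^S$ layers of $n=2^{k-1}+k$ units, for some $S\in\{0,1,\dots,2^{k-1}\}$, then $$D_{\mathrm{DBN}}\ \le\ \big(2^{k-1}-S\big)\log 2 .$$ -/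

import Mathlib

noncomputable section

namespace DeepBelief

/-! ### Maximal information divergence from a model on a finite set -/

section Divergence

variable {X : Type*} [Fintype X]

open Classical in
/-- The Kullback-Leibler divergence `D(p‖r) = ∑ x, p x * log (p x / r x)`, with `0 log 0 = 0`,
and with value `⊤` if `r` vanishes at a point where `p` does not. -/
def klDivergence (p r : X → ℝ) : EReal :=
  if ∀ x, r x = 0 → p x = 0 then ((∑ x, p x * Real.log (p x / r x) : ℝ) : EReal) else ⊤

/-- `D(p‖M) = inf_{r ∈ M} D(p‖r)`. -/
def divergenceFrom (p : X → ℝ) (M : Set (X → ℝ)) : EReal :=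
  ⨅ r ∈ M, klDivergence p r

/-- `D_M`, the largest value of `D(p‖M)` over all probability distributions `p` on `X`. -/
def maxDivergence (M : Set (X → ℝ)) : EReal :=
  ⨆ p ∈ stdSimplex ℝ X, divergenceFrom p M

end Divergence

/-! ### Deep belief networks -/

variable {n : ℕ}

/-- The joint states of one layer, whose units `i : Fin n` have state spaces of cardinality
`q i`. -/
abbrev State (q : Fin n → ℕ) : Type := ∀ i, Fin (q i)

/-- The parameters that join two consecutive layers: an interaction table for each pair of a unit
`i` of the lower layer and a unit `j` of the upper layer, and a bias for each unit of the lower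
layer. For binary units the tables give the same conditional distributions, and the same joint
distributions of a restricted Boltzmann machine, as scalar weights and scalar biases do. -/
structure LayerParams (q : Fin n → ℕ) where
  weight : ∀ i j : Fin n, Fin (q i) → Fin (q j) → ℝ
  bias : ∀ i : Fin n, Fin (q i) → ℝ

variable {q : Fin n → ℕ}

/-- The input to state `a` of the lower unit `i`, given the state `z` of the upper layer. -/
def LayerParams.input (θ : LayerParams q) (z : State q) (i : Fin n) (a : Fin (q i)) : ℝ :=
  θ.bias i a + ∑ j, θ.weight i j a (z j)

/-- The directed interaction: the conditional probability of the state `x` of the lower layer given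
the state `z` of the upper layer. The lower units are independent given `z`. -/
def LayerParams.conditional (θ : LayerParams q) (x z : State q) : ℝ :=
  ∏ i, Real.exp (θ.input z i (x i)) / ∑ a, Real.exp (θ.input z i a)

/-- The Boltzmann weight of a pair (lower state, upper state) in the restricted Boltzmann machine
with interactions and lower biases `θ` and upper biases `c`. -/
def rbmWeight (θ : LayerParams q) (c : ∀ j : Fin n, Fin (q j) → ℝ) (x z : State q) : ℝ :=
  Real.exp (∑ i, θ.bias i (x i) + ∑ j, c j (z j) + ∑ i, ∑ j, θ.weight i j (x i) (z j))

/-- The joint distribution of the two layers of the restricted Boltzmann machine. -/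
def rbmJoint (θ : LayerParams q) (c : ∀ j : Fin n, Fin (q j) → ℝ) (x z : State q) : ℝ :=
  rbmWeight θ c x z / ∑ x', ∑ z', rbmWeight θ c x' z'

/-- The parameters of a deep belief network with `T + 2` layers: `T` directed pairs of consecutive
layers below one undirected pair (the restricted Boltzmann machine on the deepest two layers). -/
structure DBNParams (q : Fin n → ℕ) (T : ℕ) where
  directed : Fin T → LayerParams q
  top : LayerParams q
  topBias : ∀ j : Fin n, Fin (q j) → ℝ

/-- The joint distribution of the layers `h 0, …, h (T + 1)`, where `h 0` is the visible layer. -/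
def DBNParams.joint {T : ℕ} (θ : DBNParams q T) (h : Fin (T + 2) → State q) : ℝ :=
  (∏ l : Fin T, (θ.directed l).conditional (h l.castSucc.castSucc) (h l.succ.castSucc)) *
    rbmJoint θ.top θ.topBias (h (Fin.last T).castSucc) (h (Fin.last (T + 1)))

/-- The distribution of the visible layer: sum the joint distribution over the hidden layers. -/
def DBNParams.visible {T : ℕ} (θ : DBNParams q T) (x : State q) : ℝ :=
  ∑ g : Fin (T + 1) → State q, θ.joint (Fin.cons x g : Fin (T + 2) → State q)

/-- The model `DBN`: all visible distributions of the deep belief networks with `L ≥ 2` layers,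
each of which consists of units with state spaces of cardinalities `q i`, `i : Fin n`. -/
def dbnModel (q : Fin n → ℕ) (L : ℕ) : Set (State q → ℝ) :=
  {p | ∃ T : ℕ, L = T + 2 ∧ ∃ θ : DBNParams q T, p = θ.visible}

end DeepBelief

end

/-!
The visible distributions of a deep belief network are obtained from the marginal of a restricted
Boltzmann machine by applying the Markov kernels of the directed layers. In the closure of the
model, a directed layer can let each unit, on a subcube of states of the layer above, draw its state
anew from a log-linear law and copy the state above otherwise, and a restricted Boltzmann machine
can realise a mixture of log-linear distributions on disjoint subcubes, one for each hidden unit.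

Divide the states into blocks by the values of some fixed units. The Boltzmann machine first puts
the probability of each block on states with value `0` in most units. Then the blocks spread it over
one more unit in each phase, all blocks simultaneously but in different units. In phase `r` this
must be done separately for each combination of the `r` values already determined, which takes at
most `q₁ ^ r` layers. After `S` phases, and thus with `2 + ∑ r < S, q₁ ^ r` layers, the closure
contains every distribution that is constant on classes of `∏ q j` states, where `j` ranges over the
units not used so far. Averaging an arbitrary distribution over classes of at most `k` states costs
a divergence of at most `log k`.
-/

noncomputable section

namespace DeepBelief

open Filter Topology Function Matrix
open scoped Finset

variable {n : ℕ} {q : Fin n → ℕ}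

section Divergence

variable {X : Type*} [Fintype X]

theorem klDivergence_le_log_of_le_mul {p r : X → ℝ} {c : ℝ} (hp : p ∈ stdSimplex ℝ X)
    (hr : ∀ x, 0 < r x) (h : ∀ x, p x ≤ c * r x) :
    klDivergence p r ≤ (Real.log c : ℝ) := by
  rw [klDivergence, if_pos fun x hx => absurd hx (hr x).ne', EReal.coe_le_coe_iff]
  calc ∑ x, p x * Real.log (p x / r x) ≤ ∑ x, p x * Real.log c := by
        refine Finset.sum_le_sum fun x _ => ?_
        rcases (hp.1 x).eq_or_lt with h0 | h0
        · rw [← h0, zero_mul, zero_mul]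
        · exact mul_le_mul_of_nonneg_left
            (Real.log_le_log (div_pos h0 (hr x)) ((div_le_iff₀ (hr x)).2 (h x))) h0.le
    _ = Real.log c := by rw [← Finset.sum_mul, hp.2, one_mul]

theorem divergenceFrom_le_log_of_mem_closure {M : Set (X → ℝ)} (hM : ∀ r ∈ M, ∀ x, 0 < r x)
    {p r : X → ℝ} {c : ℝ} (hp : p ∈ stdSimplex ℝ X) (hr : r ∈ closure M) (hc : 0 < c)
    (h : ∀ x, p x ≤ c * r x) : divergenceFrom p M ≤ (Real.log c : ℝ) := by
  have hgt : ∀ d, c < d → divergenceFrom p M ≤ (Real.log d : ℝ) := by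
    intro d hcd
    have hopen : IsOpen {r' : X → ℝ | ∀ x, p x ≠ 0 → p x < d * r' x} := by
      simp only [Set.ofPred_forall]
      exact isOpen_iInter_of_finite fun x => isOpen_iInter_of_finite fun _ =>
        isOpen_lt continuous_const (by fun_prop)
    have hmem : ∀ x, p x ≠ 0 → p x < d * r x := by
      intro x hx
      have hpx : 0 < p x := (hp.1 x).lt_of_ne' hx
      have hrx : 0 < r x := pos_of_mul_pos_right (hpx.trans_le (h x)) hc.le
      exact (h x).trans_lt (mul_lt_mul_of_pos_right hcd hrx)
    obtain ⟨r', hr', hr'M⟩ := mem_closure_iff.1 hr _ hopen hmem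
    refine (iInf₂_le r' hr'M).trans (klDivergence_le_log_of_le_mul hp (hM r' hr'M) fun x => ?_)
    rcases eq_or_ne (p x) 0 with hx | hx
    · rw [hx]
      exact (mul_pos (hc.trans hcd) (hM r' hr'M x)).le
    · exact (hr' x hx).le
  have hlim : Tendsto (fun d : ℝ => ((Real.log d : ℝ) : EReal)) (𝓝[>] c) (𝓝 (Real.log c : ℝ)) :=
    (continuous_coe_real_ereal.tendsto _).comp
      ((Real.continuousAt_log hc.ne').tendsto.mono_left nhdsWithin_le_nhds)
  exact ge_of_tendsto hlim (eventually_nhdsWithin_of_forall hgt)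

open scoped Classical in
/-- The average of `p` over the equivalence class of each point. -/
def classAverage (s : Setoid X) (p : X → ℝ) (x : X) : ℝ :=
  (∑ y with s x y, p y) / #{y : X | s x y}

open scoped Classical in
theorem filter_setoid_congr (s : Setoid X) {x y : X} (h : s x y) :
    Finset.univ.filter (s x ·) = Finset.univ.filter (s y ·) :=
  Finset.filter_congr fun _ _ => ⟨s.trans (s.symm h), s.trans h⟩

theorem classAverage_congr (s : Setoid X) (p : X → ℝ) {x y : X} (h : s x y) :
    classAverage s p x = classAverage s p y := by
  rw [classAverage, classAverage, filter_setoid_congr s h]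

open scoped Classical in
theorem card_class_pos (s : Setoid X) (x : X) : 0 < #{y : X | s x y} :=
  Finset.card_pos.2 ⟨x, by simp⟩

theorem sum_classAverage (s : Setoid X) (p : X → ℝ) : ∑ x, classAverage s p x = ∑ x, p x := by
  classical
  have hcard : ∀ x y, (if s x y then p y / #{z : X | s x z} else 0) =
      if s y x then p y / #{z : X | s y z} else 0 := by
    intro x y
    have hxy : s x y ↔ s y x := ⟨s.symm, s.symm⟩
    rw [if_congr hxy rfl rfl]
    split_ifs with h
    · rw [filter_setoid_congr s h]
    · rfl
  calc ∑ x, classAverage s p x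
      = ∑ x, ∑ y, if s x y then p y / #{z : X | s x z} else 0 := by
        simp only [classAverage, Finset.sum_div, ← Finset.sum_filter]
    _ = ∑ y, ∑ x, if s y x then p y / #{z : X | s y z} else 0 := by
        rw [Finset.sum_comm]
        simp only [hcard]
    _ = ∑ y, p y := Finset.sum_congr rfl fun y _ => by
        rw [← Finset.sum_filter, Finset.sum_const, nsmul_eq_mul, mul_div_cancel₀]
        exact_mod_cast (card_class_pos s y).ne'

theorem classAverage_mem_stdSimplex (s : Setoid X) {p : X → ℝ} (hp : p ∈ stdSimplex ℝ X) :
    classAverage s p ∈ stdSimplex ℝ X :=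
  ⟨fun _ => div_nonneg (Finset.sum_nonneg fun y _ => hp.1 y) (Nat.cast_nonneg _),
    (sum_classAverage s p).trans hp.2⟩

theorem le_mul_classAverage (s : Setoid X) {p : X → ℝ} (hp : ∀ x, 0 ≤ p x) {x : X} {k : ℕ}
    (hk : Set.ncard {y | s x y} ≤ k) : p x ≤ k * classAverage s p x := by
  classical
  have hpos : (0 : ℝ) < #{y : X | s x y} := by exact_mod_cast card_class_pos s x
  have hle : (#{y : X | s x y} : ℝ) ≤ k := by
    rw [Set.ncard_eq_toFinset_card', Set.toFinset_ofPred] at hk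
    exact_mod_cast hk
  have hsum : p x ≤ ∑ y with s x y, p y :=
    Finset.single_le_sum (fun y _ => hp y) (by simp)
  rw [classAverage, ← mul_div_assoc, le_div_iff₀ hpos, mul_comm]
  exact mul_le_mul hle hsum (hp x) (Nat.cast_nonneg _)

theorem mem_of_isClosed_of_forall_pos {M : Set (X → ℝ)} (hM : IsClosed M) (s : Setoid X)
    (h : ∀ p ∈ stdSimplex ℝ X, (∀ x, 0 < p x) → (∀ x y, s x y → p x = p y) → p ∈ M)
    {p : X → ℝ} (hp : p ∈ stdSimplex ℝ X) (hs : ∀ x y, s x y → p x = p y) : p ∈ M := by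
  have hX : Nonempty X := by
    by_contra hX
    rw [not_nonempty_iff] at hX
    simpa using hp.2
  have hcard : (0 : ℝ) < Fintype.card X := by exact_mod_cast Fintype.card_pos
  let u : X → ℝ := fun _ => (Fintype.card X : ℝ)⁻¹
  have hu : u ∈ stdSimplex ℝ X := ⟨fun _ => by positivity, by simp [u]⟩
  have hlim : Tendsto (fun η : ℝ => (1 - η) • p + η • u) (𝓝[>] 0) (𝓝 p) := by
    have hcont : Continuous fun η : ℝ => (1 - η) • p + η • u := by fun_prop
    simpa using (hcont.tendsto 0).mono_left nhdsWithin_le_nhds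
  refine hM.mem_of_tendsto hlim ?_
  filter_upwards [Ioo_mem_nhdsGT zero_lt_one] with η ⟨h0, h1⟩
  refine h _ (convex_stdSimplex ℝ X hp hu (sub_nonneg.2 h1.le) h0.le (by ring)) (fun x => ?_)
    fun x y hxy => ?_
  · exact add_pos_of_nonneg_of_pos (mul_nonneg (sub_nonneg.2 h1.le) (hp.1 x))
      (mul_pos h0 (inv_pos.2 hcard))
  · simp only [Pi.add_apply, Pi.smul_apply, hs x y hxy, u]

theorem maxDivergence_le_log_of_setoid {M : Set (X → ℝ)} (hM : ∀ r ∈ M, ∀ x, 0 < r x)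
    (s : Setoid X) {k : ℕ} (hk : ∀ x, Set.ncard {y | s x y} ≤ k)
    (h : ∀ p ∈ stdSimplex ℝ X, (∀ x, 0 < p x) → (∀ x y, s x y → p x = p y) → p ∈ closure M) :
    maxDivergence M ≤ (Real.log k : ℝ) := by
  refine iSup₂_le fun p hp => ?_
  obtain ⟨x₀⟩ : Nonempty X := by
    by_contra hX
    rw [not_nonempty_iff] at hX
    simpa using hp.2
  have hkpos : 0 < k :=
    ((Set.ncard_pos (Set.toFinite _)).2 ⟨x₀, s.refl x₀⟩).trans_le (hk x₀)
  exact divergenceFrom_le_log_of_mem_closure hM hp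
    (mem_of_isClosed_of_forall_pos isClosed_closure s h (classAverage_mem_stdSimplex s hp)
      fun x y hxy => classAverage_congr s p hxy)
    (by exact_mod_cast hkpos) fun x => le_mul_classAverage s hp.1 (hk x)

end Divergence

section Softmax

variable {A : Type*} [Fintype A]

/-- The distribution with probabilities proportional to `exp (f a)`, by which a unit with input `f`
draws its state. -/
def softmax (f : A → ℝ) (a : A) : ℝ :=
  Real.exp (f a) / ∑ b, Real.exp (f b)

theorem softmax_pos (f : A → ℝ) (a : A) : 0 < softmax f a :=
  div_pos (Real.exp_pos _) (Finset.sum_pos (fun _ _ => Real.exp_pos _) ⟨a, Finset.mem_univ a⟩)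

theorem sum_softmax [Nonempty A] (f : A → ℝ) : ∑ a, softmax f a = 1 := by
  simp only [softmax, ← Finset.sum_div]
  exact div_self (Finset.sum_pos (fun _ _ => Real.exp_pos _) Finset.univ_nonempty).ne'

theorem softmax_log {g : A → ℝ} (hg : ∀ a, 0 < g a) (a : A) :
    softmax (fun b => Real.log (g b)) a = g a / ∑ b, g b := by
  simp only [softmax, Real.exp_log (hg _)]

theorem softmax_sub_const (f : A → ℝ) (s : ℝ) (a : A) :
    softmax (fun b => f b - s) a = softmax f a := by
  simp only [softmax, Real.exp_sub, ← Finset.sum_div]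
  exact div_div_div_cancel_right₀ (Real.exp_ne_zero s) _ _

theorem tendsto_exp_add_mul_of_neg (α : ℝ) {g : ℝ} (hg : g < 0) :
    Tendsto (fun β : ℝ => Real.exp (α + β * g)) atTop (𝓝 0) :=
  Real.tendsto_exp_atBot.comp
    (tendsto_atBot_add_const_left _ _ (tendsto_id.atTop_mul_const_of_neg hg))

theorem tendsto_softmax_of_forall_lt [DecidableEq A] (α : A → ℝ) {g : A → ℝ} {b : A}
    (hg : ∀ a ≠ b, g a < g b) (a : A) :
    Tendsto (fun β : ℝ => softmax (fun c => α c + β * g c) a) atTop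
      (𝓝 (if a = b then 1 else 0)) := by
  have hexp : ∀ c, Tendsto (fun β : ℝ => Real.exp (α c + β * g c - β * g b)) atTop
      (𝓝 (if c = b then Real.exp (α c) else 0)) := by
    intro c
    split_ifs with h
    · simp [h]
    · refine (tendsto_exp_add_mul_of_neg (α c) (sub_neg.2 (hg c h))).congr fun β => ?_
      rw [mul_sub, add_sub_assoc]
  have hdiv := (hexp a).div (tendsto_finsetSum Finset.univ fun c _ => hexp c) (by simp)
  have hlim : (if a = b then Real.exp (α a) else 0) /
      ∑ c, (if c = b then Real.exp (α c) else 0) = if a = b then 1 else 0 := by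
    split_ifs with h <;> simp [h]
  rw [hlim] at hdiv
  exact hdiv.congr fun β => softmax_sub_const (fun c => α c + β * g c) (β * g b) a

end Softmax

section Layers

/-- The Markov kernel of a directed layer, as the matrix that maps a distribution of the upper layer
to the distribution of the lower layer. -/
def LayerParams.kernel (θ : LayerParams q) : Matrix (State q) (State q) ℝ :=
  of θ.conditional

theorem LayerParams.kernel_apply (θ : LayerParams q) (x z : State q) :
    θ.kernel x z = ∏ i, softmax (θ.input z i) (x i) := rfl

theorem LayerParams.kernel_pos (θ : LayerParams q) (x z : State q) : 0 < θ.kernel x z := by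
  rw [LayerParams.kernel_apply]
  exact Finset.prod_pos fun i _ => softmax_pos _ _

theorem LayerParams.sum_kernel (θ : LayerParams q) (z : State q) : ∑ x, θ.kernel x z = 1 := by
  simp only [LayerParams.kernel_apply]
  rw [← Fintype.prod_sum fun i => softmax (θ.input z i)]
  refine Finset.prod_eq_one fun i _ => ?_
  have : Nonempty (Fin (q i)) := ⟨z i⟩
  exact sum_softmax _

/-- The distribution of the lower layer of a restricted Boltzmann machine. -/
def rbmMarginal (θ : LayerParams q) (c : ∀ j : Fin n, Fin (q j) → ℝ) (x : State q) : ℝ :=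
  ∑ z, rbmJoint θ c x z

theorem rbmMarginal_eq (θ : LayerParams q) (c : ∀ j : Fin n, Fin (q j) → ℝ) (x : State q) :
    rbmMarginal θ c x = (∑ z, rbmWeight θ c x z) / ∑ x', ∑ z, rbmWeight θ c x' z :=
  (Finset.sum_div _ _ _).symm

theorem sum_rbmWeight_pos (θ : LayerParams q) (c : ∀ j : Fin n, Fin (q j) → ℝ) (x : State q) :
    0 < ∑ z, rbmWeight θ c x z :=
  Finset.sum_pos (fun _ _ => Real.exp_pos _) ⟨x, Finset.mem_univ x⟩

theorem rbmMarginal_pos (θ : LayerParams q) (c : ∀ j : Fin n, Fin (q j) → ℝ) (x : State q) :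
    0 < rbmMarginal θ c x := by
  rw [rbmMarginal_eq]
  exact div_pos (sum_rbmWeight_pos θ c x)
    (Finset.sum_pos (fun x' _ => sum_rbmWeight_pos θ c x') ⟨x, Finset.mem_univ x⟩)

theorem sum_rbmMarginal [Nonempty (State q)] (θ : LayerParams q)
    (c : ∀ j : Fin n, Fin (q j) → ℝ) : ∑ x, rbmMarginal θ c x = 1 := by
  simp only [rbmMarginal_eq, ← Finset.sum_div]
  exact div_self
    (Finset.sum_pos (fun x _ => sum_rbmWeight_pos θ c x) Finset.univ_nonempty).ne'

/-- The deep belief network `θ` with the directed layer `κ` added below it. -/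
def DBNParams.addLayer {T : ℕ} (θ : DBNParams q T) (κ : LayerParams q) : DBNParams q (T + 1) where
  directed := Fin.cons κ θ.directed
  top := θ.top
  topBias := θ.topBias

theorem DBNParams.eq_addLayer {T : ℕ} (θ : DBNParams q (T + 1)) :
    θ = (DBNParams.mk (Fin.tail θ.directed) θ.top θ.topBias).addLayer (θ.directed 0) := by
  simp only [DBNParams.addLayer, Fin.cons_self_tail]

theorem DBNParams.visible_addLayer {T : ℕ} (θ : DBNParams q T) (κ : LayerParams q) :
    (θ.addLayer κ).visible = κ.kernel *ᵥ θ.visible := by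
  funext x
  have hjoint : ∀ z (g : Fin (T + 1) → State q),
      (θ.addLayer κ).joint (Fin.cons x (Fin.cons z g : Fin (T + 2) → State q)) =
        κ.kernel x z * θ.joint (Fin.cons z g) := by
    intro z g
    rw [DBNParams.joint, Fin.prod_univ_succ, mul_assoc]
    rfl
  rw [DBNParams.visible, ← (Fin.consEquiv fun _ : Fin (T + 2) => State q).sum_comp,
    Fintype.sum_prod_type]
  refine Finset.sum_congr rfl fun z _ => ?_
  rw [DBNParams.visible, Finset.mul_sum]
  exact Finset.sum_congr rfl fun g _ => hjoint z g

theorem DBNParams.visible_eq_rbmMarginal (θ : DBNParams q 0) :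
    θ.visible = rbmMarginal θ.top θ.topBias := by
  funext x
  rw [DBNParams.visible, ← (Equiv.funUnique (Fin 1) (State q)).symm.sum_comp]
  refine Finset.sum_congr rfl fun z _ => ?_
  rw [DBNParams.joint, Finset.univ_eq_empty, Finset.prod_empty, one_mul]
  rfl

theorem rbmMarginal_mem_dbnModel (θ : LayerParams q) (c : ∀ j : Fin n, Fin (q j) → ℝ) :
    rbmMarginal θ c ∈ dbnModel q 2 :=
  ⟨0, rfl, ⟨Fin.elim0, θ, c⟩, (DBNParams.visible_eq_rbmMarginal ⟨Fin.elim0, θ, c⟩).symm⟩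

theorem kernel_mulVec_mem_dbnModel (κ : LayerParams q) {L : ℕ} {p : State q → ℝ}
    (hp : p ∈ dbnModel q L) : κ.kernel *ᵥ p ∈ dbnModel q (L + 1) := by
  obtain ⟨T, rfl, θ, rfl⟩ := hp
  exact ⟨T + 1, rfl, θ.addLayer κ, (θ.visible_addLayer κ).symm⟩

theorem dbnModel_induction {P : (State q → ℝ) → Prop} (rbm : ∀ θ c, P (rbmMarginal θ c))
    (layer : ∀ (κ : LayerParams q) p, P p → P (κ.kernel *ᵥ p)) {L : ℕ} {p : State q → ℝ}
    (hp : p ∈ dbnModel q L) : P p := by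
  obtain ⟨T, -, θ, rfl⟩ := hp
  induction T with
  | zero =>
    rw [θ.visible_eq_rbmMarginal]
    exact rbm _ _
  | succ T ih =>
    rw [θ.eq_addLayer, DBNParams.visible_addLayer]
    exact layer _ _ (ih _)

theorem pos_of_mem_dbnModel {L : ℕ} {p : State q → ℝ} (hp : p ∈ dbnModel q L) (x : State q) :
    0 < p x := by
  refine dbnModel_induction (P := fun p => ∀ x, 0 < p x) rbmMarginal_pos (fun κ p ih x => ?_) hp x
  exact Finset.sum_pos (fun z _ => mul_pos (κ.kernel_pos x z) (ih z)) ⟨x, Finset.mem_univ x⟩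

theorem sum_eq_one_of_mem_dbnModel [Nonempty (State q)] {L : ℕ} {p : State q → ℝ}
    (hp : p ∈ dbnModel q L) : ∑ x, p x = 1 := by
  refine dbnModel_induction (P := fun p => ∑ x, p x = 1) sum_rbmMarginal (fun κ p ih => ?_) hp
  simp only [mulVec, dotProduct]
  rw [Finset.sum_comm]
  simp only [← Finset.sum_mul, κ.sum_kernel, one_mul, ih]

theorem sum_eq_one_of_mem_closure_dbnModel [Nonempty (State q)] {L : ℕ} {p : State q → ℝ}
    (hp : p ∈ closure (dbnModel q L)) : ∑ x, p x = 1 :=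
  closure_minimal (fun _ => sum_eq_one_of_mem_dbnModel)
    (isClosed_eq (by fun_prop : Continuous fun p : State q → ℝ => ∑ x, p x) continuous_const) hp

theorem mulVec_mem_closure_dbnModel {L : ℕ} {p : State q → ℝ} (hp : p ∈ closure (dbnModel q L))
    {K : Matrix (State q) (State q) ℝ} (hK : K ∈ closure (Set.range LayerParams.kernel)) :
    K *ᵥ p ∈ closure (dbnModel q (L + 1)) := by
  refine map_mem_closure₂ (f := fun (K : Matrix (State q) (State q) ℝ) p => K *ᵥ p) (by fun_prop)
    hK hp ?_
  rintro _ ⟨κ, rfl⟩ p hp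
  exact kernel_mulVec_mem_dbnModel κ hp

end Layers

section Subcubes

/-- The set `C` is empty or consists of all states with prescribed values in some set `J` of units.
The values are written as those of an arbitrary member of `C`, so that the empty set is covered. -/
def IsSubcube (C : Set (State q)) : Prop :=
  ∀ v ∈ C, ∃ J : Finset (Fin n), ∀ z, z ∈ C ↔ ∀ j ∈ J, z j = v j

theorem isSubcube_empty : IsSubcube (∅ : Set (State q)) :=
  fun _ hv => hv.elim

theorem IsSubcube.exists_separable {C : Set (State q)} (hC : IsSubcube C) (hne : C.Nonempty) :
    ∃ f : ∀ j, Fin (q j) → ℝ, ∀ z, (z ∈ C → ∑ j, f j (z j) = 0) ∧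
      (z ∉ C → 1 ≤ ∑ j, f j (z j)) ∧ ∑ j, f j (z j) ≤ n := by
  obtain ⟨v, hv⟩ := hne
  obtain ⟨J, hJ⟩ := hC v hv
  let f : ∀ j, Fin (q j) → ℝ := fun j c => if j ∈ J ∧ c ≠ v j then 1 else 0
  have hf0 : ∀ j c, 0 ≤ f j c := fun j c => by simp only [f]; positivity
  have hf1 : ∀ j c, f j c ≤ 1 := fun j c => ite_le_one le_rfl zero_le_one
  refine ⟨f, fun z => ⟨fun hz => ?_, fun hz => ?_, ?_⟩⟩
  · exact Finset.sum_eq_zero fun j _ => if_neg fun h => h.2 ((hJ z).1 hz j h.1)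
  · obtain ⟨j, hj, hjv⟩ : ∃ j ∈ J, z j ≠ v j := by simpa [hJ] using hz
    calc (1 : ℝ) = f j (z j) := (if_pos ⟨hj, hjv⟩).symm
      _ ≤ _ := Finset.single_le_sum (f := fun j => f j (z j)) (fun j _ => hf0 j _)
        (Finset.mem_univ j)
  · simpa using Finset.sum_le_card_nsmul Finset.univ (fun j => f j (z j)) 1 fun j _ => hf1 j _

theorem sum_single_apply {ι : Type*} [Fintype ι] [DecidableEq ι] {X : ι → Type*} (i : ι)
    (f : X i → ℝ) (z : ∀ j, X j) : ∑ j, (Pi.single i f : ∀ j, X j → ℝ) j (z j) = f (z i) := by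
  rw [Fintype.sum_eq_single i fun j hj => by rw [Pi.single_eq_of_ne hj, Pi.zero_apply],
    Pi.single_eq_same]

theorem exists_eq_add_sum_of_subsingleton {ι : Type*} [Fintype ι] {X : ι → Type*} {F : Set ι}
    (hF : F.Subsingleton) {C : Set (∀ i, X i)} {G : (∀ i, X i) → ℝ}
    (hG : ∀ x ∈ C, ∀ y ∈ C, (∀ i ∈ F, x i = y i) → G x = G y) :
    ∃ (b : ℝ) (w : ∀ i, X i → ℝ), ∀ x ∈ C, G x = b + ∑ i, w i (x i) := by
  classical
  rcases hF.eq_empty_or_singleton with rfl | ⟨i, rfl⟩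
  · rcases C.eq_empty_or_nonempty with rfl | ⟨x₀, hx₀⟩
    · exact ⟨0, 0, fun _ hx => hx.elim⟩
    · exact ⟨G x₀, 0, fun x hx => by simpa using hG x hx x₀ hx₀⟩
  · have hfactor : FactorsThrough (fun x : C => G x) fun x : C => x.1 i := fun x y hxy =>
      hG x x.2 y y.2 (by simpa using hxy)
    refine ⟨0, Pi.single i (extend (fun x : C => x.1 i) (fun x : C => G x) 0), fun x hx => ?_⟩
    rw [sum_single_apply, zero_add]
    exact (hfactor.extend_apply 0 ⟨x, hx⟩).symm

-- States other than the common value `v i` are copied with weight `n + 1`. The input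
-- `∑ j, f j (z j) ≤ n` to `v i` is too small to prevent this, but favours `v i` off `C`.
theorem IsSubcube.exists_copy_input {C : Set (State q)} (hC : IsSubcube C) {i : Fin n}
    (hCi : ∀ y ∈ C, ∀ z ∈ C, y i = z i) :
    ∃ w : ∀ j, Fin (q i) → Fin (q j) → ℝ, ∀ z,
      (z ∈ C → ∀ a, ∑ j, w j a (z j) = 0) ∧
      (z ∉ C → ∀ a ≠ z i, ∑ j, w j a (z j) < ∑ j, w j (z i) (z j)) := by
  rcases C.eq_empty_or_nonempty with rfl | ⟨v, hv⟩
  · refine ⟨fun j a => (Pi.single i fun c => if c = a then 1 else 0 : ∀ j, Fin (q j) → ℝ) j,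
      fun z => ⟨fun hz => hz.elim, fun _ a ha => ?_⟩⟩
    simp [sum_single_apply (X := fun j => Fin (q j)), ha.symm]
  obtain ⟨f, hf⟩ := hC.exists_separable ⟨v, hv⟩
  let w : ∀ j, Fin (q i) → Fin (q j) → ℝ := fun j a => if a = v i then f j else
    (Pi.single i fun c => if c = a then (n + 1 : ℝ) else 0 : ∀ j, Fin (q j) → ℝ) j
  have hw : ∀ a (z : State q), ∑ j, w j a (z j) =
      if a = v i then ∑ j, f j (z j) else if z i = a then (n + 1 : ℝ) else 0 := by
    intro a z
    split_ifs with hav <;> simp only [w, hav, if_true, if_false]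
    all_goals simp [sum_single_apply (X := fun j => Fin (q j)), *]
  refine ⟨w, fun z => ⟨fun hz a => ?_, fun hz a ha => ?_⟩⟩
  · rw [hw, (hf z).1 hz, hCi z hz v hv]
    split_ifs with h1 h2
    · rfl
    · exact absurd h2.symm h1
    · rfl
  · have h1 := (hf z).2.1 hz
    have h2 := (hf z).2.2
    rw [hw, hw, if_pos rfl, if_neg ha.symm]
    split_ifs with hav hzv hzv
    · exact absurd (hav.trans hzv.symm) ha
    · linarith
    · linarith
    · positivity

end Subcubes

section Resampling

/-- The parameters `θ` with interaction tables moved in the direction `w`. -/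
def LayerParams.tilt (θ : LayerParams q) (w : ∀ i j, Fin (q i) → Fin (q j) → ℝ) (β : ℝ) :
    LayerParams q where
  weight i j a c := θ.weight i j a c + β * w i j a c
  bias := θ.bias

theorem LayerParams.input_tilt (θ : LayerParams q) (w : ∀ i j, Fin (q i) → Fin (q j) → ℝ) (β : ℝ)
    (z : State q) (i : Fin n) (a : Fin (q i)) :
    (θ.tilt w β).input z i a = θ.input z i a + β * ∑ j, w i j a (z j) := by
  simp only [LayerParams.tilt, LayerParams.input, Finset.sum_add_distrib, Finset.mul_sum, add_assoc]

open scoped Classical in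
/-- The kernel by which a unit `i` draws its state as in the layer `θ` if the state of the upper
layer lies in `C i`, and copies the state of the upper unit `i` otherwise. -/
def resampleKernel (θ : LayerParams q) (C : Fin n → Set (State q)) :
    Matrix (State q) (State q) ℝ :=
  of fun x z => ∏ i, if z ∈ C i then softmax (θ.input z i) (x i) else if x i = z i then 1 else 0

theorem resampleKernel_mem_closure (θ : LayerParams q) {C : Fin n → Set (State q)}
    (hC : ∀ i, IsSubcube (C i)) (hCi : ∀ i, ∀ y ∈ C i, ∀ z ∈ C i, y i = z i) :
    resampleKernel θ C ∈ closure (Set.range LayerParams.kernel) := by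
  classical
  choose w hw using fun i => (hC i).exists_copy_input (hCi i)
  have hunit : ∀ z i a, Tendsto (fun β => softmax ((θ.tilt w β).input z i) a) atTop
      (𝓝 (if z ∈ C i then softmax (θ.input z i) a else if a = z i then 1 else 0)) := by
    intro z i a
    have htilt : ∀ β, (θ.tilt w β).input z i = fun b => θ.input z i b + β * ∑ j, w i j b (z j) :=
      fun β => funext (θ.input_tilt w β z i)
    simp only [htilt]
    split_ifs with hz ha
    · simp [(hw i z).1 hz]
    · simpa [ha] using tendsto_softmax_of_forall_lt (θ.input z i) ((hw i z).2 hz) a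
    · simpa [ha] using tendsto_softmax_of_forall_lt (θ.input z i) ((hw i z).2 hz) a
  exact mem_closure_of_tendsto (f := fun β => (θ.tilt w β).kernel) (b := atTop)
    (tendsto_pi_nhds.2 fun x => tendsto_pi_nhds.2 fun z =>
      tendsto_finsetProd Finset.univ fun i _ => hunit z i (x i))
    (Eventually.of_forall fun β => ⟨_, rfl⟩)

theorem resampleKernel_apply_of_forall_notMem (θ : LayerParams q) {C : Fin n → Set (State q)}
    {z : State q} (hz : ∀ i, z ∉ C i) (x : State q) :
    resampleKernel θ C x z = (1 : Matrix (State q) (State q) ℝ) x z := by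
  simp only [resampleKernel, of_apply, if_neg (hz _), Matrix.one_apply, funext_iff,
    Fintype.prod_ite_zero, Finset.prod_const_one]

theorem resampleKernel_apply_of_mem (θ : LayerParams q) {C : Fin n → Set (State q)} {z : State q}
    {i : Fin n} (hi : z ∈ C i) (hz : ∀ j ≠ i, z ∉ C j) (x : State q) :
    resampleKernel θ C x z =
      if update z i (x i) = x then softmax (θ.input z i) (x i) else 0 := by
  classical
  have hprod : ∀ j ∈ Finset.univ.erase i, (if z ∈ C j then softmax (θ.input z j) (x j)
      else if x j = z j then 1 else 0) = if x j = z j then 1 else 0 :=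
    fun j hj => if_neg (hz j (Finset.ne_of_mem_erase hj))
  have hiff : update z i (x i) = x ↔ ∀ j ∈ Finset.univ.erase i, x j = z j := by
    simp [update_eq_iff, eq_comm (a := x _)]
  rw [resampleKernel, of_apply, ← Finset.mul_prod_erase _ _ (Finset.mem_univ i), if_pos hi,
    Finset.prod_congr rfl hprod, Finset.prod_ite_zero, Finset.prod_const_one, mul_ite, mul_one,
    mul_zero]
  exact ite_congr (propext hiff.symm) (fun _ => rfl) fun _ => rfl

theorem one_mem_closure_range_kernel :
    (1 : Matrix (State q) (State q) ℝ) ∈ closure (Set.range LayerParams.kernel) := by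
  have h : resampleKernel (q := q) ⟨0, 0⟩ (fun _ => ∅) = 1 :=
    Matrix.ext fun x z => resampleKernel_apply_of_forall_notMem _ (fun _ => Set.notMem_empty z) x
  rw [← h]
  exact resampleKernel_mem_closure _ (fun _ => isSubcube_empty) fun _ _ hy => hy.elim

theorem monotone_closure_dbnModel : Monotone fun L => closure (dbnModel q L) :=
  monotone_nat_of_le_succ fun L p hp => by
    simpa using mulVec_mem_closure_dbnModel hp one_mem_closure_range_kernel

end Resampling

section BoltzmannMixtures

theorem sum_rbmWeight (θ : LayerParams q) (c : ∀ j : Fin n, Fin (q j) → ℝ) (x : State q) :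
    ∑ z, rbmWeight θ c x z = Real.exp (∑ i, θ.bias i (x i)) *
      ∏ j, ∑ a, Real.exp (c j a + ∑ i, θ.weight i j (x i) a) := by
  rw [Fintype.prod_sum, Finset.mul_sum]
  refine Finset.sum_congr rfl fun z _ => ?_
  rw [rbmWeight, ← Real.exp_sum, ← Real.exp_add, Finset.sum_add_distrib, add_assoc,
    Finset.sum_comm (f := fun i j => θ.weight i j (x i) (z j))]

theorem inv_sum_smul_mem_closure_of_tendsto {ι : Type*} {l : Filter ι} [l.NeBot]
    {θ : ι → LayerParams q} {c : ι → ∀ j : Fin n, Fin (q j) → ℝ} {s : ι → ℝ} (hs : ∀ k, s k ≠ 0)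
    {P : State q → ℝ}
    (hP : ∀ x, Tendsto (fun k => s k * ∑ z, rbmWeight (θ k) (c k) x z) l (𝓝 (P x)))
    (hsum : ∑ x, P x ≠ 0) : (∑ x, P x)⁻¹ • P ∈ closure (dbnModel q 2) := by
  refine mem_closure_of_tendsto (f := fun k => rbmMarginal (θ k) (c k)) (b := l)
    (tendsto_pi_nhds.2 fun x => ?_)
    (Eventually.of_forall fun k => rbmMarginal_mem_dbnModel (θ k) (c k))
  rw [Pi.smul_apply, smul_eq_mul, inv_mul_eq_div]
  refine ((hP x).div (tendsto_finsetSum _ fun x' _ => hP x') hsum).congr fun k => ?_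
  rw [Pi.div_apply, ← Finset.mul_sum, mul_div_mul_left _ _ (hs k), rbmMarginal_eq]

theorem sum_exp_ite_eq {A : Type*} [Fintype A] [DecidableEq A] (s : A) (t : ℝ) :
    ∑ a, Real.exp (if a = s then t else 0) = Real.exp t + (Fintype.card A - 1) := by
  have hcard : ((#(Finset.univ.erase s) : ℕ) : ℝ) = Fintype.card A - 1 := by
    rw [Finset.card_erase_of_mem (Finset.mem_univ s), Finset.card_univ,
      Nat.cast_pred (Fintype.card_pos_iff.2 ⟨s⟩)]
  have hone : ∀ a ∈ Finset.univ.erase s, Real.exp (if a = s then t else 0) = 1 := fun a ha => by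
    rw [if_neg (Finset.ne_of_mem_erase ha), Real.exp_zero]
  rw [← Finset.add_sum_erase _ _ (Finset.mem_univ s), Finset.sum_congr rfl hone, if_pos rfl,
    Finset.sum_const, nsmul_one, hcard]

-- Only one state `s` of the hidden unit has nonzero parameters. Its energy `β - 2 * β * ∑ f + …`
-- tends to `∞` on `C`, where `∑ f = 0`, and to `-∞` off `C`, where `∑ f ≥ 1`.
theorem IsSubcube.exists_hidden_unit {A : Type*} [Fintype A] [Nonempty A] {C : Set (State q)}
    (hC : IsSubcube C) (hA : C.Nonempty → 2 ≤ Fintype.card A) (b : ℝ) (w : ∀ i, Fin (q i) → ℝ) :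
    ∃ D > 0, ∃ (c : ℝ → A → ℝ) (W : ℝ → ∀ i, Fin (q i) → A → ℝ), ∀ x : State q,
      (x ∉ C → Tendsto (fun β => ∑ a, Real.exp (c β a + ∑ i, W β i (x i) a)) atTop (𝓝 D)) ∧
      (x ∈ C → Tendsto (fun β => Real.exp (-β) * ∑ a, Real.exp (c β a + ∑ i, W β i (x i) a)) atTop
        (𝓝 (D * Real.exp (b + ∑ i, w i (x i))))) := by
  classical
  rcases C.eq_empty_or_nonempty with rfl | hne
  · exact ⟨Fintype.card A, by exact_mod_cast Fintype.card_pos, 0, 0,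
      fun x => ⟨fun _ => by simp, fun hx => hx.elim⟩⟩
  obtain ⟨f, hf⟩ := hC.exists_separable hne
  obtain ⟨s⟩ := ‹Nonempty A›
  set D : ℝ := Fintype.card A - 1
  have hD : 0 < D := sub_pos.2 (by exact_mod_cast hA hne)
  refine ⟨D, hD, fun β a => if a = s then β + b + Real.log D else 0,
    fun β i y a => if a = s then w i y - 2 * β * f i y else 0, fun x => ?_⟩
  have hfactor : ∀ β, ∑ a, Real.exp ((if a = s then β + b + Real.log D else 0) +
      ∑ i, if a = s then w i (x i) - 2 * β * f i (x i) else 0) =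
      D * Real.exp (b + ∑ i, w i (x i) + β * (1 - 2 * ∑ i, f i (x i))) + D := by
    intro β
    have hexponent : ∀ a, ((if a = s then β + b + Real.log D else 0) +
        ∑ i, if a = s then w i (x i) - 2 * β * f i (x i) else 0) =
        if a = s then Real.log D + (b + ∑ i, w i (x i) + β * (1 - 2 * ∑ i, f i (x i))) else 0 := by
      intro a
      split_ifs
      · rw [Finset.sum_sub_distrib, ← Finset.mul_sum]
        ring
      · simp
    simp only [hexponent, sum_exp_ite_eq, Real.exp_add (Real.log D), Real.exp_log hD, D]
  simp only [hfactor]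
  refine ⟨fun hx => ?_, fun hx => ?_⟩
  · have hneg : 1 - 2 * ∑ i, f i (x i) < 0 := by linarith [(hf x).2.1 hx]
    simpa using ((tendsto_exp_add_mul_of_neg (b + ∑ i, w i (x i)) hneg).const_mul D).add_const D
  · have hlim : Tendsto (fun β : ℝ => D * Real.exp (b + ∑ i, w i (x i)) + D * Real.exp (-β)) atTop
        (𝓝 (D * Real.exp (b + ∑ i, w i (x i)))) := by
      simpa using (Real.tendsto_exp_neg_atTop_nhds_zero.const_mul D).const_add
        (D * Real.exp (b + ∑ i, w i (x i)))
    refine hlim.congr fun β => ?_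
    rw [(hf x).1 hx, mul_zero, sub_zero, mul_one, Real.exp_add _ β, Real.exp_neg]
    field_simp

theorem sum_indicator_of_mem {ι X : Type*} [Fintype ι] {C : ι → Set X}
    (hdisj : Pairwise (Disjoint on C)) (E : ι → X → ℝ) {j : ι} {x : X} (hx : x ∈ C j) :
    ∑ k, (C k).indicator (E k) x = E j x := by
  rw [Fintype.sum_eq_single j fun k hk =>
    Set.indicator_of_notMem (Set.disjoint_right.1 (hdisj hk) hx) _, Set.indicator_of_mem hx]

theorem tendsto_mul_prod_of_pairwise_disjoint {ι X κ : Type*} [Fintype ι] {l : Filter κ}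
    {C : ι → Set X} (hdisj : Pairwise (Disjoint on C)) {s : κ → ℝ} (hs : Tendsto s l (𝓝 0))
    {F : ι → κ → ℝ} {D : ι → ℝ} {E : ι → X → ℝ} {x : X}
    (hF : ∀ j, x ∉ C j → Tendsto (F j) l (𝓝 (D j)))
    (hsF : ∀ j, x ∈ C j → Tendsto (fun k => s k * F j k) l (𝓝 (D j * E j x))) :
    Tendsto (fun k => s k * ∏ j, F j k) l (𝓝 ((∏ j, D j) * ∑ j, (C j).indicator (E j) x)) := by
  classical
  by_cases hx : ∃ j, x ∈ C j
  · obtain ⟨j, hj⟩ := hx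
    have herase : ∀ k ∈ Finset.univ.erase j, x ∉ C k := fun k hk =>
      Set.disjoint_right.1 (hdisj (Finset.ne_of_mem_erase hk)) hj
    rw [sum_indicator_of_mem hdisj E hj, ← Finset.mul_prod_erase _ _ (Finset.mem_univ j),
      mul_right_comm]
    refine ((hsF j hj).mul (tendsto_finsetProd _ fun k hk => hF k (herase k hk))).congr fun k => ?_
    rw [mul_assoc, Finset.mul_prod_erase _ (F · k) (Finset.mem_univ j)]
  · push Not at hx
    rw [Finset.sum_eq_zero fun j _ => Set.indicator_of_notMem (hx j) _, mul_zero,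
      ← zero_mul (∏ j, D j)]
    exact hs.mul (tendsto_finsetProd _ fun j _ => hF j (hx j))

theorem exists_smul_mem_closure_dbnModel_two {C : Fin n → Set (State q)}
    (hC : ∀ j, IsSubcube (C j)) (hdisj : Pairwise (Disjoint on C))
    (hq : ∀ j, (C j).Nonempty → 2 ≤ q j) (hne : ∃ j, (C j).Nonempty) (b : Fin n → ℝ)
    (w : Fin n → ∀ i, Fin (q i) → ℝ) :
    ∃ c : ℝ, c • (fun x => ∑ j, (C j).indicator (fun x => Real.exp (b j + ∑ i, w j i (x i))) x) ∈
      closure (dbnModel q 2) := by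
  obtain ⟨j₀, x₀, hx₀⟩ := hne
  have hnonempty : ∀ j, Nonempty (Fin (q j)) := fun j => ⟨x₀ j⟩
  choose D hD c W hunit using fun j =>
    (hC j).exists_hidden_unit (A := Fin (q j)) (by simpa using hq j) (b j) (w j)
  set E : Fin n → State q → ℝ := fun j x => Real.exp (b j + ∑ i, w j i (x i))
  set P : State q → ℝ := fun x => ∑ j, (C j).indicator (E j) x
  have hP : ∀ x, Tendsto (fun β => Real.exp (-β) * ∑ z, rbmWeight
      ⟨fun i j y a => W j β i y a, fun _ _ => 0⟩ (fun j => c j β) x z) atTop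
      (𝓝 ((∏ j, D j) * P x)) := by
    intro x
    simp only [sum_rbmWeight, Finset.sum_const_zero, Real.exp_zero, one_mul]
    exact tendsto_mul_prod_of_pairwise_disjoint hdisj Real.tendsto_exp_neg_atTop_nhds_zero
      (fun j => (hunit j x).1) fun j => (hunit j x).2
  have hsum : ∑ x, (∏ j, D j) * P x ≠ 0 := by
    rw [← Finset.mul_sum]
    refine (mul_pos (Finset.prod_pos fun j _ => hD j)
      (Finset.sum_pos' (fun x _ => ?_) ⟨x₀, Finset.mem_univ x₀, ?_⟩)).ne'
    · exact Finset.sum_nonneg fun j _ => Set.indicator_nonneg (fun _ _ => (Real.exp_pos _).le) x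
    · simp only [P, sum_indicator_of_mem hdisj E hx₀, E, Real.exp_pos]
  refine ⟨(∑ x, (∏ j, D j) * P x)⁻¹ * ∏ j, D j, ?_⟩
  rw [mul_smul]
  exact inv_sum_smul_mem_closure_of_tendsto (fun β => Real.exp_ne_zero (-β)) hP hsum

end BoltzmannMixtures

/-- The order in which probability is shared. The states of the `fixed` units divide the state space
into blocks. In phase `t` all blocks share probability simultaneously, the block of `x` in its unit
`unit x t`; since `unit_eq_iff` assigns different units to different blocks, one directed layer can
do this. A `free` unit takes no part in the sharing before its turn, if any, comes. -/
structure SharingScheme (q : Fin n → ℕ) where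
  fixed : Finset (Fin n)
  free : Finset (Fin n)
  length : ℕ
  unit : State q → ℕ → Fin n
  unit_eq_iff : ∀ {x y t}, unit x t = unit y t ↔ ∀ i ∈ fixed, x i = y i
  unit_notMem_fixed : ∀ x t, unit x t ∉ fixed
  unit_injOn : ∀ x, Set.InjOn (unit x) (Set.Iio length)
  cover : ∀ x i, i ∈ fixed ∨ i ∈ free ∨ ∃ t < length, unit x t = i
  free_subsingleton : (free : Set (Fin n)).Subsingleton
  two_le : ∀ x t, 2 ≤ q (unit x t)

namespace SharingScheme

variable (A : SharingScheme q)

theorem unit_congr {x y : State q} (h : ∀ i ∈ A.fixed, x i = y i) : A.unit x = A.unit y :=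
  funext fun _ => A.unit_eq_iff.2 h

theorem unit_update (x : State q) (r : ℕ) (a : Fin (q (A.unit x r))) :
    A.unit (update x (A.unit x r) a) = A.unit x :=
  A.unit_congr fun _ hi => update_of_ne (ne_of_mem_of_not_mem hi (A.unit_notMem_fixed x r)) _ _

/-- The state of `x` read off in the order of sharing, with values in `ℕ` because the state spaces
of the units `unit x t` vary with `x` and `t`. -/
def word (x : State q) (t : ℕ) : ℕ := x (A.unit x t)

theorem word_update_self (x : State q) (r : ℕ) (a : Fin (q (A.unit x r))) :
    A.word (update x (A.unit x r) a) r = a := by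
  rw [word, A.unit_update, update_self]

theorem word_update_of_ne {x : State q} {r t : ℕ} (hr : r < A.length) (ht : t < A.length)
    (hne : t ≠ r) (a : Fin (q (A.unit x r))) :
    A.word (update x (A.unit x r) a) t = A.word x t := by
  rw [word, A.unit_update, update_of_ne fun h => hne (A.unit_injOn x ht hr h), word]

/-- The first `d` letters of the word of `x`. -/
def wordPrefix (d : ℕ) (x : State q) : Fin d → ℕ := fun t => A.word x t

theorem wordPrefix_update {r d : ℕ} (hr : r < A.length) (hd : d ≤ r) (x : State q)
    (a : Fin (q (A.unit x r))) :
    A.wordPrefix d (update x (A.unit x r) a) = A.wordPrefix d x :=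
  funext fun t => A.word_update_of_ne hr (by omega) (by omega) a

theorem wordPrefix_succ_eq_iff {d : ℕ} {x : State q} {u : Fin (d + 1) → ℕ} :
    A.wordPrefix (d + 1) x = u ↔
      A.wordPrefix d x = Fin.init u ∧ A.word x d = u (Fin.last d) := by
  simp only [funext_iff, Fin.forall_fin_succ', wordPrefix, Fin.init, Fin.val_castSucc, Fin.val_last]

theorem isSubcube_setOf_wordPrefix_eq (r d : ℕ) (i : Fin n) (u : Fin d → ℕ) :
    IsSubcube {x | A.unit x r = i ∧ A.wordPrefix d x = u} := by
  classical
  rintro v ⟨rfl, rfl⟩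
  refine ⟨A.fixed ∪ Finset.univ.image fun t : Fin d => A.unit v t, fun z => ?_⟩
  have hword : A.unit z = A.unit v →
      (A.wordPrefix d z = A.wordPrefix d v ↔ ∀ t : Fin d, z (A.unit v t) = v (A.unit v t)) := by
    intro hzv
    have hletter : ∀ t, A.word z t = z (A.unit v t) := fun t => by rw [word, hzv]
    simp only [funext_iff, wordPrefix, hletter, Fin.ext_iff]
    rfl
  simp only [Finset.mem_union, or_imp, forall_and, Finset.mem_image, Finset.mem_univ, true_and,
    forall_exists_index, forall_apply_eq_imp_iff, Set.mem_ofPred_eq, A.unit_eq_iff]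
  exact and_congr_right fun hfixed => hword (A.unit_congr hfixed)

/-- Two states are equivalent if they agree on the fixed units, the free units and the units of the
first `d` phases. -/
def agreeUpTo (d : ℕ) : Setoid (State q) where
  r x y := (∀ i ∈ A.fixed ∪ A.free, x i = y i) ∧ A.wordPrefix d x = A.wordPrefix d y
  iseqv := ⟨fun _ => ⟨fun _ _ => rfl, rfl⟩, fun h => ⟨fun i hi => (h.1 i hi).symm, h.2.symm⟩,
    fun h h' => ⟨fun i hi => (h.1 i hi).trans (h'.1 i hi), h.2.trans h'.2⟩⟩

theorem unit_eq_of_agreeUpTo {d : ℕ} {x y : State q} (h : A.agreeUpTo d x y) :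
    A.unit x = A.unit y :=
  A.unit_congr fun i hi => h.1 i (Finset.mem_union_left _ hi)

theorem agreeUpTo_update {d : ℕ} {x y : State q} (h : A.agreeUpTo d x y)
    (a : Fin (q (A.unit x d))) :
    A.agreeUpTo (d + 1) (update x (A.unit x d) a) (update y (A.unit x d) a) := by
  have hunit := A.unit_eq_of_agreeUpTo h
  refine ⟨fun i hi => ?_, ?_⟩
  · obtain rfl | hne := eq_or_ne i (A.unit x d)
    · simp only [update_self]
    · simp only [update_of_ne hne, h.1 i hi]
  · have hx : A.unit (update x (A.unit x d) a) = A.unit x := A.unit_update x d a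
    have hy : A.unit (update y (A.unit x d) a) = A.unit x :=
      (A.unit_congr fun i hi => update_of_ne
        (ne_of_mem_of_not_mem hi (A.unit_notMem_fixed x d)) _ _).trans hunit.symm
    funext t
    rw [wordPrefix, wordPrefix, word, word, hx, hy]
    obtain heq | hne := eq_or_ne (A.unit x t) (A.unit x d)
    · rw [heq, update_self, update_self]
    · have ht : (t : ℕ) < d := lt_of_le_of_ne (by omega) fun htd => hne (by rw [htd])
      have hword : A.word x t = A.word y t := congrFun h.2 ⟨t, ht⟩
      rw [update_of_ne hne, update_of_ne hne]
      rwa [word, word, ← hunit] at hword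

/-- The sum of `p` over the states of the unit in which the block of `x` shares in phase `r`. -/
def sumOut (r : ℕ) (p : State q → ℝ) (x : State q) : ℝ :=
  ∑ a, p (update x (A.unit x r) a)

theorem sumOut_pos {r : ℕ} {p : State q → ℝ} (hp : ∀ x, 0 < p x) (x : State q) :
    0 < A.sumOut r p x :=
  Finset.sum_pos (fun _ _ => hp _) ⟨x _, Finset.mem_univ _⟩

theorem sumOut_congr {r : ℕ} {p : State q → ℝ}
    (hp : ∀ x y, A.agreeUpTo (r + 1) x y → p x = p y) {x y : State q} (h : A.agreeUpTo r x y) :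
    A.sumOut r p x = A.sumOut r p y := by
  rw [sumOut, sumOut, ← A.unit_eq_of_agreeUpTo h]
  exact Finset.sum_congr rfl fun a _ => hp _ _ (A.agreeUpTo_update h a)

/-- The states whose letters in the phases `a ≤ t < b` are `0`, the state in which the probability
of a block is concentrated before it is shared. -/
def resting (a b : ℕ) : Set (State q) := {x | ∀ t ∈ Set.Ico a b, A.word x t = 0}

/-- The state `x` with the letter `r` of its word replaced by `0`. -/
def reset (r : ℕ) (x : State q) : State q := update x (A.unit x r) ⟨0, (x (A.unit x r)).pos⟩

theorem unit_reset (r : ℕ) (x : State q) : A.unit (A.reset r x) = A.unit x :=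
  A.unit_update x r _

theorem word_reset_self (r : ℕ) (x : State q) : A.word (A.reset r x) r = 0 :=
  A.word_update_self x r _

theorem val_reset_apply (r : ℕ) (x : State q) (i : Fin n) :
    (A.reset r x i : ℕ) = if i = A.unit x r then 0 else (x i : ℕ) := by
  split_ifs with hi
  · subst hi
    rw [reset, update_self]
  · rw [reset, update_of_ne hi]

theorem update_eq_iff_eq_reset {r : ℕ} {x z : State q} (hz : A.word z r = 0) :
    update z (A.unit z r) (x (A.unit z r)) = x ↔ z = A.reset r x := by
  constructor
  · intro h
    have hunit : A.unit x = A.unit z := h ▸ A.unit_update z r _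
    ext i
    rw [val_reset_apply, hunit]
    split_ifs with hi
    · rw [hi, ← hz, word]
    · rw [← h, update_of_ne hi]
  · rintro rfl
    rw [A.unit_reset, reset, update_idem, update_eq_self]

theorem wordPrefix_reset {r : ℕ} (hr : r < A.length) (x : State q) :
    A.wordPrefix r (A.reset r x) = A.wordPrefix r x :=
  A.wordPrefix_update hr le_rfl x _

theorem reset_mem_resting_iff {r D : ℕ} (hr : r < D) (hD : D ≤ A.length) (x : State q) :
    A.reset r x ∈ A.resting r D ↔ x ∈ A.resting (r + 1) D := by
  have hother : ∀ t < A.length, t ≠ r → A.word (A.reset r x) t = A.word x t :=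
    fun t ht hne => A.word_update_of_ne (hr.trans_le hD) ht hne _
  refine ⟨fun h t ht => ?_, fun h t ht => ?_⟩
  · rw [← hother t (ht.2.trans_le hD) (by grind), h t ⟨by grind, ht.2⟩]
  · obtain rfl | hne := eq_or_ne t r
    · exact A.word_reset_self t x
    · rw [hother t (ht.2.trans_le hD) hne, h t ⟨by grind, ht.2⟩]

/-- The states in which the unit `j` shares in phase `r`, when the prefix `w` has its turn. -/
def gate (r : ℕ) (w : Fin r → ℕ) (j : Fin n) : Set (State q) :=
  {z | A.unit z r = j ∧ A.wordPrefix (r + 1) z = (Fin.snoc w 0 : Fin (r + 1) → ℕ)}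

theorem mem_gate_iff {r : ℕ} {w : Fin r → ℕ} {j : Fin n} {z : State q} :
    z ∈ A.gate r w j ↔ A.unit z r = j ∧ A.wordPrefix r z = w ∧ A.word z r = 0 := by
  rw [gate, Set.mem_ofPred_eq, wordPrefix_succ_eq_iff, Fin.init_snoc, Fin.snoc_last]

theorem eqOn_gate {r : ℕ} {w : Fin r → ℕ} {j : Fin n} :
    ∀ y ∈ A.gate r w j, ∀ z ∈ A.gate r w j, y j = z j := by
  intro y hy z hz
  obtain ⟨rfl, -, hy0⟩ := A.mem_gate_iff.1 hy
  obtain ⟨hunit, -, hz0⟩ := A.mem_gate_iff.1 hz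
  rw [word, hunit] at hz0
  exact Fin.ext (hy0.trans hz0.symm)

-- Within a gate all states agree on the fixed units and on the word up to `r`, so `p` can only
-- depend on the single unit that may be free, and is therefore within reach of the pair
-- interactions.
theorem exists_input_eq_log {r : ℕ} {p : State q → ℝ}
    (hinv : ∀ x y, A.agreeUpTo (r + 1) x y → p x = p y) (w : Fin r → ℕ) :
    ∃ θ : LayerParams q, ∀ j, ∀ z ∈ A.gate r w j, ∀ a,
      θ.input z j a = Real.log (p (update z j a)) := by
  have hfree : ∀ j a, ∃ (b : ℝ) (v : ∀ i, Fin (q i) → ℝ), ∀ z ∈ A.gate r w j,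
      Real.log (p (update z j a)) = b + ∑ i, v i (z i) := by
    refine fun j a => exists_eq_add_sum_of_subsingleton A.free_subsingleton fun y hy z hz hyz => ?_
    obtain ⟨rfl, hyw, -⟩ := A.mem_gate_iff.1 hy
    obtain ⟨hunit, hzw, -⟩ := A.mem_gate_iff.1 hz
    have hagree : A.agreeUpTo r y z := by
      refine ⟨fun i hi => ?_, hyw.trans hzw.symm⟩
      exact (Finset.mem_union.1 hi).elim (A.unit_eq_iff.1 hunit.symm i) (hyz i)
    rw [hinv _ _ (A.agreeUpTo_update hagree a)]
  choose b v hv using hfree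
  exact ⟨⟨fun i j a => v i a j, b⟩, fun j z hz a => (hv j a z hz).symm⟩

theorem exists_sharing_kernel {r : ℕ} {p : State q → ℝ} (hp : ∀ x, 0 < p x)
    (hinv : ∀ x y, A.agreeUpTo (r + 1) x y → p x = p y) (w : Fin r → ℕ) :
    ∃ K ∈ closure (Set.range LayerParams.kernel), ∀ x z,
      (A.wordPrefix r z = w → A.word z r = 0 →
        K x z = if z = A.reset r x then p x / A.sumOut r p z else 0) ∧
      (¬(A.wordPrefix r z = w ∧ A.word z r = 0) →
        K x z = (1 : Matrix (State q) (State q) ℝ) x z) := by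
  obtain ⟨θ, hθ⟩ := A.exists_input_eq_log hinv w
  refine ⟨resampleKernel θ (A.gate r w), resampleKernel_mem_closure θ
    (fun j => A.isSubcube_setOf_wordPrefix_eq r (r + 1) j _) fun j => A.eqOn_gate,
    fun x z => ⟨fun hw h0 => ?_, fun hz => ?_⟩⟩
  · have hmem : z ∈ A.gate r w (A.unit z r) := A.mem_gate_iff.2 ⟨rfl, hw, h0⟩
    rw [resampleKernel_apply_of_mem θ hmem fun j hj hzj => hj (A.mem_gate_iff.1 hzj).1.symm]
    refine ite_congr (propext (A.update_eq_iff_eq_reset h0)) (fun hx => ?_) fun _ => rfl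
    rw [funext (hθ _ z hmem), softmax_log fun a => hp _, (A.update_eq_iff_eq_reset h0).2 hx, sumOut]
  · exact resampleKernel_apply_of_forall_notMem θ (fun j hj => hz (A.mem_gate_iff.1 hj).2) x

open scoped Classical in
/-- The measure reached in phase `r` when the states whose prefix lies in `W` have already shared
their probability. The letters `t` with `r < t < D` are still at rest. -/
def stage (r D : ℕ) (p : State q → ℝ) (W : Finset (Fin r → ℕ)) (x : State q) : ℝ :=
  if A.wordPrefix r x ∈ W then (A.resting (r + 1) D).indicator p x
  else (A.resting r D).indicator (A.sumOut r p) x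

theorem exists_mulVec_stage {r D : ℕ} (hr : r < D) (hD : D ≤ A.length) {p : State q → ℝ}
    (hp : ∀ x, 0 < p x) (hinv : ∀ x y, A.agreeUpTo (r + 1) x y → p x = p y)
    {W : Finset (Fin r → ℕ)} {w : Fin r → ℕ} (hw : w ∉ W) :
    ∃ K ∈ closure (Set.range LayerParams.kernel),
      K *ᵥ A.stage r D p W = A.stage r D p (insert w W) := by
  classical
  obtain ⟨K, hK, hKx⟩ := A.exists_sharing_kernel hp hinv w
  refine ⟨K, hK, funext fun x => ?_⟩
  have hreset : A.wordPrefix r (A.reset r x) = A.wordPrefix r x :=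
    A.wordPrefix_reset (hr.trans_le hD) x
  by_cases hx : A.wordPrefix r x = w
  · have hzero : ∀ z ≠ A.reset r x, K x z * A.stage r D p W z = 0 := by
      intro z hz
      by_cases hzw : A.wordPrefix r z = w ∧ A.word z r = 0
      · rw [(hKx x z).1 hzw.1 hzw.2, if_neg hz, zero_mul]
      obtain rfl | hne := eq_or_ne x z
      · have hnotMem : x ∉ A.resting r D := fun h => hzw ⟨hx, h r ⟨le_rfl, hr⟩⟩
        rw [stage, if_neg (hx ▸ hw), Set.indicator_of_notMem hnotMem, mul_zero]
      · rw [(hKx x z).2 hzw, Matrix.one_apply_ne hne, zero_mul]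
    rw [mulVec, dotProduct, Fintype.sum_eq_single _ hzero, stage, stage, hreset, if_neg (hx ▸ hw),
      if_pos (hx ▸ Finset.mem_insert_self _ _),
      (hKx x _).1 (hreset.trans hx) (A.word_reset_self r x), if_pos rfl]
    simp only [Set.indicator_apply, A.reset_mem_resting_iff hr hD, mul_ite, mul_zero,
      div_mul_cancel₀ _ (A.sumOut_pos hp _).ne']
  · have hzero : ∀ z ≠ x, K x z * A.stage r D p W z = 0 := by
      intro z hz
      by_cases hzw : A.wordPrefix r z = w ∧ A.word z r = 0
      · rw [(hKx x z).1 hzw.1 hzw.2, if_neg, zero_mul]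
        rintro rfl
        exact hx (hreset ▸ hzw.1)
      · rw [(hKx x z).2 hzw, Matrix.one_apply_ne hz.symm, zero_mul]
    rw [mulVec, dotProduct, Fintype.sum_eq_single _ hzero, (hKx x x).2 fun h => hx h.1,
      Matrix.one_apply_eq, one_mul, stage, stage]
    simp only [Finset.mem_insert, hx, false_or]

theorem stage_empty (r D : ℕ) (p : State q → ℝ) :
    A.stage r D p ∅ = (A.resting r D).indicator (A.sumOut r p) :=
  funext fun _ => if_neg (Finset.notMem_empty _)

theorem stage_of_forall_mem {r : ℕ} {W : Finset (Fin r → ℕ)} (hW : ∀ x, A.wordPrefix r x ∈ W)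
    (D : ℕ) (p : State q → ℝ) : A.stage r D p W = (A.resting (r + 1) D).indicator p :=
  funext fun x => if_pos (hW x)

theorem smul_stage_mem_closure {r D L : ℕ} (hr : r < D) (hD : D ≤ A.length) {p : State q → ℝ}
    (hp : ∀ x, 0 < p x) (hinv : ∀ x y, A.agreeUpTo (r + 1) x y → p x = p y) {c : ℝ}
    (hc : c • A.stage r D p ∅ ∈ closure (dbnModel q L)) (W : Finset (Fin r → ℕ)) :
    c • A.stage r D p W ∈ closure (dbnModel q (L + #W)) := by
  classical
  induction W using Finset.induction_on with
  | empty => exact hc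
  | insert w W hw ih =>
    obtain ⟨K, hK, hstage⟩ := A.exists_mulVec_stage hr hD hp hinv hw
    rw [← hstage, ← Matrix.mulVec_smul, Finset.card_insert_of_notMem hw]
    exact mulVec_mem_closure_dbnModel ih hK

theorem mem_resting_zero_iff {D : ℕ} {x : State q} : x ∈ A.resting 0 D ↔ A.wordPrefix D x = 0 := by
  simp only [resting, Set.mem_ofPred_eq, funext_iff, Fin.forall_iff, wordPrefix, Pi.zero_apply,
    Set.mem_Ico, zero_le, true_and]

theorem exists_smul_indicator_resting_zero_mem_closure [Nonempty (State q)] (D : ℕ)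
    {p : State q → ℝ} (hp : ∀ x, 0 < p x) (hinv : ∀ x y, A.agreeUpTo 0 x y → p x = p y) :
    ∃ c : ℝ, c • (A.resting 0 D).indicator p ∈ closure (dbnModel q 2) := by
  let C : Fin n → Set (State q) := fun j => {x | A.unit x 0 = j ∧ A.wordPrefix D x = 0}
  have hblock : ∀ j, ∃ (b : ℝ) (v : ∀ i, Fin (q i) → ℝ), ∀ x ∈ C j,
      Real.log (p x) = b + ∑ i, v i (x i) := by
    refine fun j => exists_eq_add_sum_of_subsingleton A.free_subsingleton ?_
    rintro x ⟨rfl, -⟩ y ⟨hunit, -⟩ hxy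
    refine congrArg Real.log (hinv x y ⟨fun i hi => ?_, Subsingleton.elim _ _⟩)
    exact (Finset.mem_union.1 hi).elim (A.unit_eq_iff.1 hunit.symm i) (hxy i)
  choose b v hv using hblock
  have hp_eq : (A.resting 0 D).indicator p = fun x =>
      ∑ j, (C j).indicator (fun x => Real.exp (b j + ∑ i, v j i (x i))) x := by
    funext x
    rw [Fintype.sum_eq_single (A.unit x 0)
      fun j hj => Set.indicator_of_notMem (fun hx => hj hx.1.symm) _]
    by_cases hx : x ∈ A.resting 0 D
    · have hxC : x ∈ C (A.unit x 0) := ⟨rfl, A.mem_resting_zero_iff.1 hx⟩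
      rw [Set.indicator_of_mem hx, Set.indicator_of_mem hxC, ← hv _ x hxC, Real.exp_log (hp x)]
    · rw [Set.indicator_of_notMem hx,
        Set.indicator_of_notMem fun h => hx (A.mem_resting_zero_iff.2 h.2)]
  obtain ⟨x₀⟩ := ‹Nonempty (State q)›
  let o : State q := fun i => ⟨0, (x₀ i).pos⟩
  rw [hp_eq]
  exact exists_smul_mem_closure_dbnModel_two
    (fun j => A.isSubcube_setOf_wordPrefix_eq 0 D j 0)
    (fun i j hij => Set.disjoint_left.2 fun x hi hj => hij (hi.1.symm.trans hj.1))
    (fun j ⟨x, hx⟩ => hx.1 ▸ A.two_le x 0) ⟨_, o, rfl, rfl⟩ b v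

theorem exists_smul_indicator_resting_mem_closure [Nonempty (State q)] {Q D : ℕ}
    (hQ : ∀ x t, q (A.unit x t) ≤ Q) (hD : D ≤ A.length) {S : ℕ} (hS : S ≤ D) {p : State q → ℝ}
    (hp : ∀ x, 0 < p x) (hinv : ∀ x y, A.agreeUpTo S x y → p x = p y) :
    ∃ c : ℝ, c • (A.resting S D).indicator p ∈
      closure (dbnModel q (2 + ∑ r ∈ Finset.range S, Q ^ r)) := by
  induction S generalizing p with
  | zero => exact A.exists_smul_indicator_resting_zero_mem_closure D hp hinv
  | succ S ih =>
    obtain ⟨c, hc⟩ := ih (by omega) (A.sumOut_pos hp) fun x y => A.sumOut_congr hinv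
    rw [← A.stage_empty] at hc
    have hmem := A.smul_stage_mem_closure hS hD hp hinv hc
      (Fintype.piFinset fun _ => Finset.range Q)
    rw [A.stage_of_forall_mem fun x => Fintype.mem_piFinset.2 fun t => Finset.mem_range.2
        ((x _).isLt.trans_le (hQ x t)),
      Fintype.card_piFinset_const, Finset.card_range, add_assoc,
      ← Finset.sum_range_succ] at hmem
    exact ⟨c, hmem⟩

theorem mem_closure_dbnModel {Q S : ℕ} (hQ : ∀ x t, q (A.unit x t) ≤ Q) (hS : S ≤ A.length)
    {p : State q → ℝ} (hp : p ∈ stdSimplex ℝ (State q)) (hpos : ∀ x, 0 < p x)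
    (hinv : ∀ x y, A.agreeUpTo S x y → p x = p y) :
    p ∈ closure (dbnModel q (2 + ∑ r ∈ Finset.range S, Q ^ r)) := by
  have hne : Nonempty (State q) := by
    by_contra hne
    rw [not_nonempty_iff] at hne
    simpa using hp.2
  obtain ⟨c, hc⟩ := A.exists_smul_indicator_resting_mem_closure hQ hS le_rfl hpos hinv
  have huniv : A.resting S S = Set.univ := by simp [resting]
  rw [huniv, Set.indicator_univ] at hc
  have hsum := sum_eq_one_of_mem_closure_dbnModel hc
  simp only [Pi.smul_apply, smul_eq_mul, ← Finset.mul_sum, hp.2, mul_one] at hsum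
  simpa only [hsum, one_smul] using hc

theorem ncard_agreeUpTo_le (S : ℕ) (x : State q) :
    Set.ncard {y | A.agreeUpTo S x y} ≤ ∏ t ∈ Finset.Ico S A.length, q (A.unit x t) := by
  classical
  let f : State q → ∀ t : Finset.Ico S A.length, Fin (q (A.unit x t)) := fun y t => y (A.unit x t)
  have hf : Set.InjOn f {y | A.agreeUpTo S x y} := by
    intro y hy z hz hyz
    funext i
    rcases A.cover x i with hi | hi | ⟨t, ht, rfl⟩
    · exact (hy.1 i (Finset.mem_union_left _ hi)).symm.trans (hz.1 i (Finset.mem_union_left _ hi))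
    · exact (hy.1 i (Finset.mem_union_right _ hi)).symm.trans
        (hz.1 i (Finset.mem_union_right _ hi))
    · obtain htS | htS := lt_or_ge t S
      · have hword : A.word y t = A.word z t := congrFun (hy.2.symm.trans hz.2) ⟨t, htS⟩
        rw [word, word, ← A.unit_eq_of_agreeUpTo hy, ← A.unit_eq_of_agreeUpTo hz] at hword
        exact Fin.ext hword
      · exact congrFun hyz ⟨t, Finset.mem_Ico.2 ⟨htS, ht⟩⟩
  calc Set.ncard {y | A.agreeUpTo S x y} = Set.ncard (f '' {y | A.agreeUpTo S x y}) :=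
        hf.ncard_image.symm
    _ ≤ Nat.card (∀ t : Finset.Ico S A.length, Fin (q (A.unit x t))) := Set.ncard_le_card _
    _ = ∏ t ∈ Finset.Ico S A.length, q (A.unit x t) := by
        rw [Nat.card_eq_fintype_card, Fintype.card_pi]
        simp only [Fintype.card_fin]
        exact Finset.prod_coe_sort (Finset.Ico S A.length) fun t => q (A.unit x t)

theorem maxDivergence_le {S Q L k : ℕ} (hS : S ≤ A.length) (hQ : ∀ x t, q (A.unit x t) ≤ Q)
    (hL : 2 + ∑ r ∈ Finset.range S, Q ^ r ≤ L)
    (hk : ∀ x, ∏ t ∈ Finset.Ico S A.length, q (A.unit x t) ≤ k) :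
    maxDivergence (dbnModel q L) ≤ (Real.log k : ℝ) :=
  maxDivergence_le_log_of_setoid (fun _ => pos_of_mem_dbnModel) (A.agreeUpTo S)
    (fun x => (A.ncard_agreeUpTo_le S x).trans (hk x)) fun _ hp hpos hinv =>
      monotone_closure_dbnModel hL (A.mem_closure_dbnModel hQ hS hp hpos hinv)

end SharingScheme

section CyclicScheme

/-- The scheme in which phase `t` of the block with tail `b`, the states of the units beyond `m`,
takes place in the unit `e b + t` modulo `m`. The unit `m`, if there is one, is free. -/
def cyclicScheme {m : ℕ} (hm : 0 < m) (hmn : m ≤ n) (hq : ∀ i : Fin n, (i : ℕ) < m → 2 ≤ q i)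
    (e : (∀ i : {i : Fin n // m < (i : ℕ)}, Fin (q i)) ↪ Fin m) : SharingScheme q where
  fixed := {i | m < (i : ℕ)}
  free := {i | (i : ℕ) = m}
  length := m
  unit x t := ⟨(e (Subtype.restrict _ x) + t) % m, (Nat.mod_lt _ hm).trans_le hmn⟩
  unit_eq_iff {x y t} := by
    rw [Fin.mk.injEq]
    refine ⟨fun h i hi => ?_, fun h => ?_⟩
    · have htail := e.injective <| Fin.ext <|
        (Nat.ModEq.add_right_cancel' t h).eq_of_lt_of_lt (e _).isLt (e _).isLt
      exact congrFun htail ⟨i, by simpa using hi⟩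
    · have htail : Subtype.restrict (fun i : Fin n => m < (i : ℕ)) x = Subtype.restrict _ y :=
        funext fun i => h i (Finset.mem_filter.2 ⟨Finset.mem_univ _, i.2⟩)
      rw [htail]
  unit_notMem_fixed x t := by simpa using (Nat.mod_lt _ hm).le
  unit_injOn x t ht t' ht' h :=
    (Nat.ModEq.add_left_cancel' _ (Fin.mk.inj h)).eq_of_lt_of_lt ht ht'
  cover x i := by
    rcases lt_trichotomy (i : ℕ) m with h | h | h
    · let c : ℕ := e (Subtype.restrict _ x)
      have hc : c < m := (e _).isLt
      have hcycle : (c + (i + (m - c)) % m) % m = i := by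
        rw [Nat.add_mod_mod, show c + (i + (m - c)) = i + m by omega, Nat.add_mod_right,
          Nat.mod_eq_of_lt h]
      exact Or.inr (Or.inr ⟨_, Nat.mod_lt _ hm, Fin.ext hcycle⟩)
    · exact Or.inr (Or.inl (by simpa using h))
    · exact Or.inl (by simpa using h)
  free_subsingleton i hi j hj := by
    simp only [Finset.coe_filter, Finset.mem_univ, true_and, Set.mem_ofPred_eq] at hi hj
    exact Fin.ext (hi.trans hj.symm)
  two_le x t := hq _ (Nat.mod_lt _ hm)

theorem prod_le_prod_Icc_card {f : ℕ → ℕ} {m : ℕ} (hf : AntitoneOn f (Set.Icc 1 m))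
    {s : Finset ℕ} (hs : (s : Set ℕ) ⊆ Set.Icc 1 m) :
    ∏ j ∈ s, f j ≤ ∏ j ∈ Finset.Icc 1 #s, f j := by
  induction s using Finset.induction_on_max with
  | empty => simp
  | insert a s ha ih =>
    have hnot : a ∉ s := fun h => (ha a h).false
    rw [Finset.coe_insert, Set.insert_subset_iff] at hs
    obtain ⟨ham, hs⟩ := hs
    have hcard : #s ≤ a - 1 := by
      simpa using Finset.card_le_card fun x hx =>
        Finset.mem_Icc.2 ⟨(hs hx).1, Nat.le_sub_one_of_lt (ha x hx)⟩
    rw [Finset.prod_insert hnot, Finset.card_insert_of_notMem hnot,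
      Finset.prod_Icc_succ_top (by omega), mul_comm]
    have ha1 := ham.1
    have ha2 := ham.2
    exact Nat.mul_le_mul (ih hs) (hf ⟨by omega, by omega⟩ ham (by omega))

theorem prod_Ico_add_mod_le {f : ℕ → ℕ} {m : ℕ} (hm : 0 < m) (hf : AntitoneOn f (Set.Icc 1 m))
    (c S : ℕ) :
    ∏ t ∈ Finset.Ico S m, f ((c + t) % m + 1) ≤ ∏ j ∈ Finset.Icc 1 (m - S), f j := by
  have hinj : Set.InjOn (fun t => (c + t) % m + 1) (Finset.Ico S m) := fun t ht t' ht' h =>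
    (Nat.ModEq.add_left_cancel' c (Nat.succ_injective h)).eq_of_lt_of_lt
      (Finset.mem_Ico.1 ht).2 (Finset.mem_Ico.1 ht').2
  have himage : ((Finset.Ico S m).image fun t => (c + t) % m + 1 : Set ℕ) ⊆ Set.Icc 1 m := by
    rw [Finset.coe_image]
    rintro _ ⟨t, -, rfl⟩
    exact ⟨Nat.succ_pos _, Nat.mod_lt _ hm⟩
  simpa only [Finset.prod_image hinj, Finset.card_image_of_injOn hinj, Nat.card_Ico] using
    prod_le_prod_Icc_card hf himage

theorem prod_fin_gt_eq_prod_Icc {M : Type*} [CommMonoid M] (n m : ℕ) (f : ℕ → M) :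
    ∏ i : {i : Fin n // m < (i : ℕ)}, f (i + 1) = ∏ j ∈ Finset.Icc (m + 2) n, f j := by
  refine Finset.prod_bij (fun i _ => (i.1 : ℕ) + 1) (fun i _ => ?_) (fun i _ j _ h => ?_)
    (fun j hj => ?_) fun _ _ => rfl
  · exact Finset.mem_Icc.2 ⟨Nat.succ_le_succ i.2, i.1.isLt⟩
  · exact Subtype.ext (Fin.ext (Nat.succ_injective h))
  · obtain ⟨h1, h2⟩ := Finset.mem_Icc.1 hj
    exact ⟨⟨⟨j - 1, by omega⟩, Nat.lt_sub_of_add_lt h1⟩, Finset.mem_univ _,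
      Nat.sub_add_cancel (by omega)⟩

theorem maxDivergence_dbnModel_le {n m S L : ℕ} {q : ℕ → ℕ} (hm : 0 < m) (hmn : m ≤ n)
    (hq : ∀ j ∈ Set.Icc 1 m, 2 ≤ q j) (hanti : AntitoneOn q (Set.Icc 1 m))
    (hprod : ∏ j ∈ Finset.Icc (m + 2) n, q j ≤ m) (hS : S ≤ m)
    (hL : 2 + ∑ r ∈ Finset.range S, q 1 ^ r ≤ L) :
    maxDivergence (dbnModel (fun i : Fin n => q (i + 1)) L) ≤
      (Real.log (∏ j ∈ Finset.Icc 1 (m - S), (q j : ℝ)) : ℝ) := by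
  obtain ⟨e⟩ : Nonempty ((∀ i : {i : Fin n // m < (i : ℕ)}, Fin (q (i + 1))) ↪ Fin m) := by
    refine Embedding.nonempty_of_card_le ?_
    simpa only [Fintype.card_pi, Fintype.card_fin, prod_fin_gt_eq_prod_Icc n m q] using hprod
  have hmod : ∀ a, a % m + 1 ∈ Set.Icc 1 m := fun a => ⟨Nat.succ_pos _, Nat.mod_lt a hm⟩
  rw [← Nat.cast_prod]
  exact (cyclicScheme (q := fun i : Fin n => q (i + 1)) hm hmn
      (fun i hi => hq _ ⟨Nat.succ_pos _, hi⟩) e).maxDivergence_le hS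
    (fun _ _ => hanti ⟨le_rfl, hm⟩ (hmod _) (Nat.succ_pos _)) hL
    fun _ => prod_Ico_add_mod_le hm hanti _ S

end CyclicScheme

end DeepBelief

end

theorem mainTheorem1 :
    (∀ (n m S L : ℕ) (q : ℕ → ℕ),
      (∀ j ∈ Finset.Icc 1 n, 1 ≤ q j) →
      (∀ j ∈ Finset.Icc 1 m, 2 ≤ q j) →
      ∏ j ∈ Finset.Icc (m + 2) n, q j ≤ m →
      m ≤ n →
      (∀ i ∈ Finset.Icc 1 m, ∀ j ∈ Finset.Icc 1 m, i ≤ j → q j ≤ q i) →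
      S ≤ m →
      (2 : ℝ) + ((q 1 : ℝ) ^ S - 1) / ((q 1 : ℝ) - 1) ≤ (L : ℝ) →
      DeepBelief.maxDivergence (DeepBelief.dbnModel (fun i : Fin n => q ((i : ℕ) + 1)) L)
        ≤ ((Real.log (∏ j ∈ Finset.Icc 1 (m - S), (q j : ℝ)) : ℝ) : EReal)) ∧
    (∀ (k S L : ℕ),
      1 ≤ k →
      S ≤ 2 ^ (k - 1) →
      1 + 2 ^ S ≤ L →
      DeepBelief.maxDivergence (DeepBelief.dbnModel (fun _ : Fin (2 ^ (k - 1) + k) => 2) L)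
        ≤ ((((2 : ℝ) ^ (k - 1) - (S : ℝ)) * Real.log 2 : ℝ) : EReal)) := by
  refine ⟨fun n m S L q hq hq2 hprod hmn hanti hS hL => ?_, fun k S L hk hS hL => ?_⟩
  · have hm : 0 < m := (Finset.prod_pos fun j hj => hq j (by grind)).trans_le hprod
    have hq1 : 1 < q 1 := hq2 1 (Finset.mem_Icc.2 ⟨le_rfl, hm⟩)
    have hlayers : 2 + ∑ r ∈ Finset.range S, q 1 ^ r ≤ L := by
      rw [← geom_sum_eq (by exact_mod_cast hq1.ne')] at hL
      exact_mod_cast hL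
    exact DeepBelief.maxDivergence_dbnModel_le hm hmn (fun j hj => hq2 j (Finset.mem_Icc.2 hj))
      (fun i hi j hj => hanti i (Finset.mem_Icc.2 hi) j (Finset.mem_Icc.2 hj)) hprod hS hlayers
  · have hprod : ∏ _j ∈ Finset.Icc (2 ^ (k - 1) + 2) (2 ^ (k - 1) + k), 2 ≤ 2 ^ (k - 1) := by
      rw [Finset.prod_const, Nat.card_Icc]
      exact Nat.pow_le_pow_right two_pos (by omega)
    have hlayers : 2 + ∑ r ∈ Finset.range S, 2 ^ r ≤ L := by
      have := Nat.geomSum_lt le_rfl (n := S) (s := Finset.range S) (by simp)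
      omega
    have hle := DeepBelief.maxDivergence_dbnModel_le (q := fun _ => 2) (by positivity)
      (Nat.le_add_right _ k) (fun _ _ => le_rfl) (fun _ _ _ _ _ => le_rfl) hprod hS hlayers
    simpa [Real.log_pow, Nat.cast_sub hS] using hle
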